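/- Let $(R,\mathfrak m)$ be a Cohen–Macaulay (Noetherian) local ring of Krull dimension $d\ge 1$ with infinite residue field, let $I$ be an $\mathfrak m$-primary ideal, and let $x\in I$ be a superficial element for $I$, i.e. there is an integer $c\ge 1$ such that $(I^{n+1}:x)\cap I^{c}=I^{n}$ for all $n\ge c$. Put $S=R/(x)$ and $I'=I/(x)\subseteq S$. For an ideal $J$ that is primary to the maximal ideal of a Noetherian local ring $A$, let $H_J(n)=\lambda(A/J^n)$ for $n\in\mathbb Z$ (where $\lambda$ is length and $J^n=A$ for $n\le 0$, so $H_J(n)=0$ for $n\le 0$), let $P_J$ be the polynomial with $P_J(n)=H_J(n)$ for all $n\gg 0$, and let $\operatorname{n}(J)=\min\{n\in\mathbb Z : P_J(t)=H_J(t)\text{ for all } t>n\}$ be the postulation number of $J$. Let $\widetilde{J}=\bigcup_{k\ge 1}(J^{k+1}:J^{k})$ be the Ratliff–Rush closure of $J$, and let $\rho(I)=\min\{i\ge 1 : \widetilde{I^{n}}=I^{n}\text{ for all } n\ge i\}$. Then: 1. if $\operatorname{n}(I)>\rho(I)-1$, then $\operatorname{n}(I')=\operatorname{n}(I)+1$;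 2. if $\operatorname{n}(I)=\rho(I)-1$, then $\operatorname{n}(I')\le \operatorname{n}(I)+1$; 3. if $\operatorname{n}(I)<\rho(I)-1$, then $\operatorname{n}(I')\ge \operatorname{n}(I)+1$. -/

import Mathlib

open Polynomial Filter

/-- A Noetherian local ring `(R, 𝔪)` is Cohen–Macaulay if its depth equals its Krull dimension:
some `R`-regular sequence of elements of `𝔪` has length `dim R`. -/
def IsCohenMacaulayLocal (R : Type*) [CommRing R] [IsLocalRing R] : Prop :=
  IsNoetherianRing R ∧
    ∃ rs : List R, (∀ r ∈ rs, r ∈ IsLocalRing.maximalIdeal R) ∧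
      RingTheory.Sequence.IsRegular R rs ∧ (rs.length : WithBot ℕ∞) = ringKrullDim R

namespace Ideal

variable {R : Type*} [CommRing R]

/-- `I` is `𝔪`-primary: a primary ideal whose radical is the maximal ideal `𝔪`. -/
def IsMaximalPrimary [IsLocalRing R] (I : Ideal R) : Prop :=
  I.IsPrimary ∧ I.radical = IsLocalRing.maximalIdeal R

/-- The Hilbert–Samuel function `H_I(n) = λ(R / Iⁿ)` on all of `ℤ`, where `Iⁿ = R` for `n ≤ 0`
(so `H_I(n) = 0` there). -/
noncomputable def hilbertSamuelFun (I : Ideal R) (n : ℤ) : ℕ :=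
  (Module.length R (R ⧸ I ^ n.toNat)).toNat

/-- `P` is a Hilbert–Samuel polynomial of `I`: `P(n) = H_I(n)` for all large `n`. -/
def IsHilbertSamuelPoly (I : Ideal R) (P : ℚ[X]) : Prop :=
  ∀ᶠ n : ℤ in atTop, P.eval (n : ℚ) = I.hilbertSamuelFun n

/-- There is at most one Hilbert–Samuel polynomial. -/
theorem IsHilbertSamuelPoly.unique {I : Ideal R} {P Q : ℚ[X]}
    (hP : I.IsHilbertSamuelPoly P) (hQ : I.IsHilbertSamuelPoly Q) : P = Q := by
  obtain ⟨N, hN⟩ := eventually_atTop.1 (hP.and hQ)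
  refine Polynomial.eq_of_infinite_eval_eq P Q ?_
  refine ((Set.Ici_infinite N).image (Int.cast_injective (α := ℚ)).injOn).mono ?_
  rintro _ ⟨n, hn, rfl⟩
  exact (hN n hn).1.trans (hN n hn).2.symm

open Classical in
/-- The Hilbert–Samuel polynomial `P_I` (with junk value `0` when there is none). -/
noncomputable def hilbertSamuelPoly (I : Ideal R) : ℚ[X] :=
  if h : ∃ P : ℚ[X], I.IsHilbertSamuelPoly P then h.choose else 0

theorem IsHilbertSamuelPoly.hilbertSamuelPoly_eq {I : Ideal R} {P : ℚ[X]}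
    (hP : I.IsHilbertSamuelPoly P) : I.hilbertSamuelPoly = P := by
  have h : ∃ P : ℚ[X], I.IsHilbertSamuelPoly P := ⟨P, hP⟩
  rw [hilbertSamuelPoly, dif_pos h]
  exact h.choose_spec.unique hP

/-- The postulation number `n(I) = min {n ∈ ℤ : P_I(t) = H_I(t) for all t > n}`. -/
noncomputable def postulationNumber (I : Ideal R) : ℤ :=
  sInf {n : ℤ | ∀ t : ℤ, n < t → I.hilbertSamuelPoly.eval (t : ℚ) = I.hilbertSamuelFun t}

/-- The Ratliff–Rush closure of `I`: the union of the increasing chain of ideals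
`(Iⁿ⁺¹ : Iⁿ)`, `n ≥ 1`. -/
def ratliffRush (I : Ideal R) : Ideal R :=
  ⨆ n : ℕ, ⨆ _ : 1 ≤ n, (I ^ (n + 1)).colon (I ^ n : Ideal R)

/-- The supremum defining `ratliffRush` is the union. -/
theorem mem_ratliffRush {I : Ideal R} {a : R} :
    a ∈ I.ratliffRush ↔ ∃ n : ℕ, 1 ≤ n ∧ ∀ b ∈ I ^ n, a * b ∈ I ^ (n + 1) := by
  have hmono : Monotone fun n : ℕ ↦ (I ^ (n + 1)).colon ((I ^ n : Ideal R) : Set R) := by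
    refine monotone_nat_of_le_succ fun n a ha ↦ ?_
    rw [Submodule.mem_colon] at ha ⊢
    intro s hs
    have hs' : s ∈ I ^ n * I := by rwa [← pow_succ]
    rw [pow_succ]
    refine Submodule.mul_induction_on hs' (fun b hb c hc ↦ ?_) fun b c hb hc ↦ ?_
    · rw [smul_eq_mul, ← mul_assoc]
      exact Ideal.mul_mem_mul (ha b hb) hc
    · rw [smul_add]
      exact add_mem hb hc
  have h : I.ratliffRush = ⨆ n : ℕ, (I ^ (n + 1)).colon ((I ^ n : Ideal R) : Set R) :=
    le_antisymm (iSup_le fun n ↦ iSup_le fun _ ↦ le_iSup_of_le n le_rfl)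
      (iSup_le fun n ↦ le_trans (hmono n.le_succ)
        (le_iSup_of_le (n + 1) (le_iSup_of_le n.succ_pos le_rfl)))
  rw [h, Submodule.mem_iSup_of_directed _ hmono.directed_le]
  constructor
  · rintro ⟨n, hn⟩
    exact ⟨n + 1, n.succ_pos, Submodule.mem_colon.1 (hmono n.le_succ hn)⟩
  · rintro ⟨n, _, hn⟩
    exact ⟨n, Submodule.mem_colon.2 hn⟩

/-- The stability index of the Ratliff–Rush filtration of `I`: the least `i ≥ 1` such that the
Ratliff–Rush closure of `Iⁿ` is `Iⁿ` for all `n ≥ i`. -/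
noncomputable def stabilityIndex (I : Ideal R) : ℕ :=
  sInf {i : ℕ | 1 ≤ i ∧ ∀ n : ℕ, i ≤ n → (I ^ n).ratliffRush = I ^ n}

/-- `x` is a superficial element for `I`: `x ∈ I` and, for some positive `c`,
`(Iⁿ⁺¹ : x) ∩ I^c = Iⁿ` for all `n ≥ c`. -/
def IsSuperficial (I : Ideal R) (x : R) : Prop :=
  x ∈ I ∧ ∃ c : ℕ, 1 ≤ c ∧ ∀ n : ℕ, c ≤ n → (I ^ (n + 1)).colon {x} ⊓ I ^ c = I ^ n

/-- The ideal `I' = I / (x)` of `S = R / (x)`: the image of `I`. -/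
abbrev modElement (I : Ideal R) (x : R) : Ideal (R ⧸ Ideal.span {x}) :=
  I.map (Ideal.Quotient.mk (Ideal.span {x}))

end Ideal

/-!
Let `Δ_J = P_J - H_J`. The postulation number `n(J)` is the largest integer at which `Δ_J` does not
vanish: such integers exist because a polynomial vanishing at all `t ≤ 0` is zero while
`H_J(1) ≠ 0`, and they are bounded because `H_J` is eventually polynomial.

Comparing lengths in `0 → R / (Iⁿ⁺¹ : x) → R / Iⁿ⁺¹ → R / (Iⁿ⁺¹ + (x)) → 0` shows that
`H_I(n + 1) - H_I(n) ≤ H_{I'}(n + 1)`, with equality if and only if `(Iⁿ⁺¹ : x) = Iⁿ`. As `I`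
contains a nonzerodivisor and `x` is superficial, equality holds for large `n`, so that
`P_{I'}(t) = P_I(t) - P_I(t - 1)` and `(Iⁿ⁺¹ : x) = Iⁿ` becomes
`Δ_{I'}(n + 1) = Δ_I(n + 1) - Δ_I(n)`. Moreover, for `n ≥ 1`, `a` lies in the Ratliff–Rush closure
of `Iⁿ` if and only if `a xᵏ ∈ Iⁿ⁺ᵏ` for some `k`, so `ρ(I)` is the least `i ≥ 1` such that
`(Iⁿ⁺¹ : x) = Iⁿ` for all `n ≥ i`. Hence `Δ_{I'}(t) = Δ_I(t) - Δ_I(t - 1)` for `t > ρ(I)` and for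
`t ≤ 0`, and this identity fails at `t = ρ(I)` when `ρ(I) > 1`. Evaluating it around `t = n(I) + 1`
gives the three cases.
-/

/-- `u n` is the value at `n` of some polynomial for all large `n`. -/
def EventuallyPolynomial (u : ℕ → ℚ) : Prop :=
  ∃ P : ℚ[X], ∀ᶠ n in atTop, u n = P.eval (n : ℚ)

namespace EventuallyPolynomial

variable {u v : ℕ → ℚ}

theorem of_eventually_eq_zero (h : ∀ᶠ n in atTop, u n = 0) : EventuallyPolynomial u :=
  ⟨0, h.mono fun n hn ↦ by rw [hn, eval_zero]⟩

theorem add (hu : EventuallyPolynomial u) (hv : EventuallyPolynomial v) :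
    EventuallyPolynomial (u + v) := by
  obtain ⟨P, hP⟩ := hu
  obtain ⟨Q, hQ⟩ := hv
  exact ⟨P + Q, (hP.and hQ).mono fun n ⟨hPn, hQn⟩ ↦ by rw [Pi.add_apply, eval_add, hPn, hQn]⟩

theorem comp_succ (hu : EventuallyPolynomial u) : EventuallyPolynomial fun n ↦ u (n + 1) := by
  obtain ⟨P, hP⟩ := hu
  refine ⟨P.comp (X + 1), ((tendsto_add_atTop_nat 1).eventually hP).mono fun n hn ↦ ?_⟩
  simp [hn]

theorem of_comp_succ (hu : EventuallyPolynomial fun n ↦ u (n + 1)) : EventuallyPolynomial u := by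
  obtain ⟨P, hP⟩ := hu
  obtain ⟨N, hN⟩ := eventually_atTop.1 hP
  refine ⟨P.comp (X - 1), eventually_atTop.2 ⟨N + 1, fun n hn ↦ ?_⟩⟩
  obtain ⟨m, rfl⟩ := Nat.exists_eq_add_of_le' (Nat.one_le_of_lt hn)
  simp [hN m (by omega)]

end EventuallyPolynomial

theorem exists_eval_add_one_sub_eval (P : ℚ[X]) :
    ∃ Q : ℚ[X], ∀ t : ℚ, Q.eval (t + 1) - Q.eval t = P.eval t := by
  induction P using Polynomial.induction_on' with
  | add P₁ P₂ h₁ h₂ =>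
    obtain ⟨Q₁, h₁⟩ := h₁
    obtain ⟨Q₂, h₂⟩ := h₂
    refine ⟨Q₁ + Q₂, fun t ↦ ?_⟩
    rw [eval_add, eval_add, eval_add, ← h₁, ← h₂]
    ring
  | monomial k a =>
    refine ⟨C (a / (k + 1)) * Polynomial.bernoulli (k + 1), fun t ↦ ?_⟩
    have hk : (k : ℚ) + 1 ≠ 0 := by positivity
    rw [add_comm t 1, eval_C_mul, eval_C_mul, bernoulli_eval_one_add, eval_monomial]
    push_cast
    field_simp
    simp [mul_assoc]

theorem EventuallyPolynomial.of_succ_sub {u : ℕ → ℚ}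
    (h : EventuallyPolynomial fun n ↦ u (n + 1) - u n) : EventuallyPolynomial u := by
  obtain ⟨P, hP⟩ := h
  obtain ⟨Q, hQ⟩ := exists_eval_add_one_sub_eval P
  obtain ⟨N, hN⟩ := eventually_atTop.1 hP
  refine ⟨Q + C (u N - Q.eval (N : ℚ)), eventually_atTop.2 ⟨N, fun n hn ↦ ?_⟩⟩
  induction n, hn using Nat.le_induction with
  | base => simp
  | succ n hn ih =>
    have hu := hN n hn
    have hQn := hQ n
    simp only [eval_add, eval_C] at ih ⊢
    push_cast
    linarith

section RelLength

variable {R M N : Type*} [Ring R] [AddCommGroup M] [AddCommGroup N] [Module R M] [Module R N]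

/-- The length of `A / (A ∩ B)`, the analogue for lengths of `Subgroup.relIndex`; it is the length
of `A / B` when `B ≤ A`. -/
noncomputable def relLength (B A : Submodule R M) : ℕ∞ :=
  Module.length R (A ⧸ B.comap A.subtype)

theorem length_map_eq_relLength_ker (φ : M →ₗ[R] N) (A : Submodule R M) :
    Module.length R (A.map φ) = relLength (LinearMap.ker φ) A := by
  rw [← LinearMap.range_domRestrict, ← (φ.domRestrict A).quotKerEquivRange.length_eq,
    LinearMap.ker_domRestrict, relLength]

theorem relLength_eq_length_map_mkQ (B A : Submodule R M) :
    relLength B A = Module.length R (A.map B.mkQ) := by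
  rw [length_map_eq_relLength_ker, B.ker_mkQ]

theorem relLength_map (φ : M →ₗ[R] N) (B : Submodule R N) (A : Submodule R M) :
    relLength B (A.map φ) = relLength (B.comap φ) A := by
  rw [relLength_eq_length_map_mkQ, ← Submodule.map_comp, length_map_eq_relLength_ker,
    LinearMap.ker_comp, B.ker_mkQ]

theorem relLength_inf_left (B A : Submodule R M) : relLength (B ⊓ A) A = relLength B A := by
  rw [relLength, Submodule.comap_inf, Submodule.comap_subtype_self, inf_top_eq, relLength]

theorem relLength_sup_right (B A : Submodule R M) : relLength B (B ⊔ A) = relLength B A := by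
  rw [relLength_eq_length_map_mkQ, Submodule.map_sup, Submodule.mkQ_map_self, bot_sup_eq,
    relLength_eq_length_map_mkQ]

theorem relLength_top (B : Submodule R M) : relLength B ⊤ = Module.length R (M ⧸ B) := by
  rw [relLength_eq_length_map_mkQ, Submodule.map_top, B.range_mkQ, Module.length_top]

theorem relLength_eq_zero_iff {B A : Submodule R M} : relLength B A = 0 ↔ A ≤ B := by
  rw [relLength, Module.length_eq_zero_iff, Submodule.Quotient.subsingleton_iff,
    Submodule.comap_subtype_eq_top]

theorem length_quotient_eq_relLength_add {C B : Submodule R M} (h : C ≤ B) :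
    Module.length R (M ⧸ C) = relLength C B + Module.length R (M ⧸ B) := by
  rw [Module.length_eq_add_of_exact _ _ (Submodule.subtype_injective (B.map C.mkQ))
    (Submodule.mkQ_surjective _) (LinearMap.exact_subtype_mkQ _),
    (Submodule.quotientQuotientEquivQuotient C B h).length_eq, relLength_eq_length_map_mkQ]

theorem relLength_add_relLength {C B A : Submodule R M} (hCB : C ≤ B) (hBA : B ≤ A) :
    relLength C B + relLength B A = relLength C A := by
  rw [relLength, relLength, relLength,
    length_quotient_eq_relLength_add (Submodule.comap_mono (f := A.subtype) hCB),
    ← relLength_map, Submodule.map_comap_subtype, inf_eq_right.2 hBA, relLength]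

theorem relLength_le_relLength_of_le {C B : Submodule R M} (h : C ≤ B) (A : Submodule R M) :
    relLength B A ≤ relLength C A :=
  Module.length_le_of_surjective _
    (Submodule.factor_surjective (Submodule.comap_mono (f := A.subtype) h))

end RelLength

section Filtration

variable {R M : Type*} [CommRing R] [AddCommGroup M] [Module R M] {I : Ideal R}

/-- The filtration with terms `f Fₙ₋₁`, that is, the multiples of `F` by `f` placed in degree one
of the Rees algebra, except that the term of degree `0` is `f F₀` because a filtration has to be
decreasing. -/
def filtrationShiftMap (f : R) (F : I.Filtration M) : I.Filtration M where
  N n := (F.N (n - 1)).map (LinearMap.lsmul R M f)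
  mono n := Submodule.map_mono (F.antitone (by omega))
  smul_le n := by
    rw [← Submodule.map_smul'']
    refine Submodule.map_mono ?_
    cases n with
    | zero => exact Submodule.smul_le_right
    | succ n => exact F.smul_le n

/-- The filtration with terms `(Fₙ₊₁ : f)`, that is, the colon of `F` by `f` placed in degree one
of the Rees algebra. -/
def filtrationShiftComap (f : R) (F : I.Filtration M) : I.Filtration M where
  N n := (F.N (n + 1)).comap (LinearMap.lsmul R M f)
  mono n := Submodule.comap_mono (F.mono (n + 1))
  smul_le n := by
    rw [← Submodule.map_le_iff_le_comap, Submodule.map_smul'']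
    exact (Submodule.smul_mono le_rfl <| Submodule.map_comap_le _ _).trans (F.smul_le (n + 1))

theorem filtrationShiftMap_le {f : R} (hf : f ∈ I) (F : I.Filtration M) :
    filtrationShiftMap f F ≤ F := by
  rintro (_ | n) _ ⟨a, ha, rfl⟩
  · exact (F.N 0).smul_mem f ha
  · exact F.smul_le n (Submodule.smul_mem_smul hf ha)

theorem le_filtrationShiftComap {f : R} (hf : f ∈ I) (F : I.Filtration M) :
    F ≤ filtrationShiftComap f F :=
  fun n _ ha ↦ F.smul_le n (Submodule.smul_mem_smul hf ha)

theorem relLength_succ_eq_add {F G : I.Filtration M} (hFG : F ≤ G) {f : R} (hf : f ∈ I) (n : ℕ) :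
    relLength (F.N (n + 1)) (G.N (n + 1)) =
      relLength ((F ⊔ filtrationShiftMap f G).N (n + 1)) (G.N (n + 1)) +
        relLength ((filtrationShiftComap f F ⊓ G).N n) (G.N n) := by
  have hle : F ⊔ filtrationShiftMap f G ≤ G := sup_le hFG (filtrationShiftMap_le hf G)
  rw [← relLength_add_relLength (le_sup_left (b := filtrationShiftMap f G) (n + 1)) (hle (n + 1)),
    add_comm]
  congr 1
  exact (relLength_sup_right _ _).trans
    ((relLength_map _ _ _).trans (relLength_inf_left _ _).symm)

theorem filtration_submodule_le_submodule_iff {F G : I.Filtration M} :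
    F.submodule ≤ G.submodule ↔ F ≤ G := by
  refine ⟨fun h n a ha ↦ ?_, fun h _ hp n ↦ h n (hp n)⟩
  have hmem : PolynomialModule.single R n a ∈ F.submodule := fun i ↦ by
    rw [PolynomialModule.coeff_single, Finsupp.single_apply]
    split_ifs with hi
    · exact hi ▸ ha
    · exact zero_mem _
  simpa using h hmem n

theorem wellFoundedGT_Iic_of_stable [IsNoetherianRing R] [Module.Finite R M] {G : I.Filtration M}
    (hG : G.Stable) : WellFoundedGT (Set.Iic G) := by
  have hnoeth : IsNoetherian (reesAlgebra I) G.submodule :=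
    isNoetherian_of_fg_of_noetherian _
      ((G.submodule_fg_iff_stable fun _ ↦ IsNoetherian.noetherian _).2 hG)
  let toIic (F : Set.Iic G) : Set.Iic G.submodule :=
    ⟨F.1.submodule, filtration_submodule_le_submodule_iff.2 F.2⟩
  have htoIic : StrictMono toIic :=
    strictMono_of_le_iff_le fun _ _ ↦ filtration_submodule_le_submodule_iff.symm
  exact ((Submodule.mapIic G.submodule).symm.strictMono.comp htoIic).wellFoundedGT

/-- The Hilbert function `n ↦ λ(Gₙ / (Fₙ ∩ Gₙ))` of `G` modulo `F`, with junk value `0` where the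
length is infinite. -/
noncomputable def relHilbertFun (F G : I.Filtration M) (n : ℕ) : ℚ :=
  (relLength (F.N n) (G.N n)).toNat

theorem relHilbertFun_succ_eq_add {F G : I.Filtration M} (hFG : F ≤ G)
    (hfin : ∀ n, relLength (F.N n) (G.N n) ≠ ⊤) {f : R} (hf : f ∈ I) (n : ℕ) :
    relHilbertFun F G (n + 1) = relHilbertFun (F ⊔ filtrationShiftMap f G) G (n + 1) +
      relHilbertFun (filtrationShiftComap f F ⊓ G) G n := by
  have hadd := relLength_succ_eq_add hFG hf n
  have htop := hfin (n + 1)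
  rw [hadd, Ne, ENat.add_eq_top, not_or] at htop
  rw [relHilbertFun, hadd, ENat.toNat_add htop.1 htop.2, Nat.cast_add, relHilbertFun,
    relHilbertFun]

theorem eventuallyPolynomial_relHilbertFun [IsNoetherianRing R] [Module.Finite R M]
    {F G : I.Filtration M} (hG : G.Stable) (hFG : F ≤ G)
    (hfin : ∀ n, relLength (F.N n) (G.N n) ≠ ⊤) :
    EventuallyPolynomial (relHilbertFun F G) := by
  -- Noetherian induction on `F`. An element `f ∈ I`, acting in degree one, either kills
  -- `⨁ Gₙ / Fₙ`, or has a cokernel given by a larger `F` and a kernel `⨁ ((Fₙ₊₁ : f) ∩ Gₙ) / Fₙ`,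
  -- where `(Fₙ₊₁ : f) ∩ Gₙ` is larger than `F` too unless the kernel vanishes.
  have := wellFoundedGT_Iic_of_stable hG
  lift F to Set.Iic G using hFG
  induction F using WellFoundedGT.induction with
  | _ F ih
  have ih' {E : I.Filtration M} (hFE : F.1 < E) (hEG : E ≤ G) :
      EventuallyPolynomial (relHilbertFun E G) :=
    ih ⟨E, hEG⟩ hFE fun n ↦
      ne_top_of_le_ne_top (hfin n) (relLength_le_relLength_of_le (hFE.le n) _)
  by_cases hshift : ∀ f ∈ I, filtrationShiftMap f G ≤ F.1
  · obtain ⟨N, hN⟩ := hG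
    refine .of_comp_succ (.of_eventually_eq_zero (eventually_atTop.2 ⟨N, fun n hn ↦ ?_⟩))
    have hle : G.N (n + 1) ≤ F.1.N (n + 1) := by
      rw [← hN n hn, Submodule.smul_le]
      exact fun f hf a ha ↦ hshift f hf (n + 1) (Submodule.mem_map_of_mem ha)
    rw [relHilbertFun, relLength_eq_zero_iff.2 hle, ENat.toNat_zero, Nat.cast_zero]
  · push Not at hshift
    obtain ⟨f, hf, hfF⟩ := hshift
    have hsup : EventuallyPolynomial fun n ↦
        relHilbertFun (F.1 ⊔ filtrationShiftMap f G) G (n + 1) :=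
      (ih' (left_lt_sup.2 hfF) (sup_le F.2 (filtrationShiftMap_le hf G))).comp_succ
    have hadd := relHilbertFun_succ_eq_add F.2 hfin hf
    obtain hlt | heq := (le_inf (le_filtrationShiftComap hf F.1) F.2).lt_or_eq
    · exact .of_comp_succ (funext hadd ▸ hsup.add (ih' hlt inf_le_right))
    · simp only [← heq, ← sub_eq_iff_eq_add] at hadd
      exact .of_succ_sub (funext hadd ▸ hsup)

end Filtration

section HilbertSamuel

variable {R : Type*} [CommRing R] {I J : Ideal R} {x : R}

theorem isArtinianRing_quotient_of_le_radical [IsNoetherianRing R] [IsArtinianRing (R ⧸ I)]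
    (h : I ≤ J.radical) : IsArtinianRing (R ⧸ J) := by
  have hmax := I.krullDimLE_zero_quotient_iff_forall_minimalPrimes_isMaximal.1
    (isArtinianRing_iff_krullDimLE_zero.1 ‹IsArtinianRing (R ⧸ I)›)
  refine isArtinianRing_iff_krullDimLE_zero.2
    (J.krullDimLE_zero_quotient_iff_forall_minimalPrimes_isMaximal.2 fun p hp ↦ ?_)
  have hpp : p.IsPrime := hp.1.1
  obtain ⟨q, hq, hqp⟩ := Ideal.exists_minimalPrimes_le (h.trans (hpp.radical_le_iff.2 hp.1.2))
  exact (hmax q hq).eq_of_le hpp.ne_top hqp ▸ hmax q hq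

theorem length_quotient_ne_top [IsArtinianRing (R ⧸ J)] : Module.length R (R ⧸ J) ≠ ⊤ := by
  rw [Module.length_eq_of_surjective (S := R) (R := R ⧸ J) Ideal.Quotient.mk_surjective]
  exact Module.length_ne_top

theorem length_quotient_pow_ne_top [IsNoetherianRing R] [IsArtinianRing (R ⧸ I)] (n : ℕ) :
    Module.length R (R ⧸ I ^ n) ≠ ⊤ :=
  have : IsArtinianRing (R ⧸ I ^ n) := isArtinianRing_quotient_of_le_radical fun _ ha ↦
    ⟨n, Ideal.pow_mem_pow ha n⟩
  length_quotient_ne_top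

theorem coe_hilbertSamuelFun [IsNoetherianRing R] [IsArtinianRing (R ⧸ I)] (t : ℤ) :
    (I.hilbertSamuelFun t : ℕ∞) = Module.length R (R ⧸ I ^ t.toNat) :=
  ENat.natCast_toNat (length_quotient_pow_ne_top _)

theorem hilbertSamuelFun_of_nonpos {t : ℤ} (ht : t ≤ 0) : I.hilbertSamuelFun t = 0 := by
  have : Subsingleton (R ⧸ I ^ 0) := Ideal.Quotient.subsingleton_iff.2 (by simp)
  rw [Ideal.hilbertSamuelFun, Int.toNat_of_nonpos ht, Module.length_eq_zero, ENat.toNat_zero]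

theorem hilbertSamuelFun_one_ne_zero [IsNoetherianRing R] [IsArtinianRing (R ⧸ I)] (hI : I ≠ ⊤) :
    I.hilbertSamuelFun 1 ≠ 0 := fun h ↦ by
  have hlen := coe_hilbertSamuelFun (I := I) 1
  rw [h, Int.toNat_one, pow_one, Nat.cast_zero, eq_comm, Module.length_eq_zero_iff,
    Ideal.Quotient.subsingleton_iff] at hlen
  exact hI hlen

theorem exists_isHilbertSamuelPoly [IsNoetherianRing R] [IsArtinianRing (R ⧸ I)] :
    ∃ P : ℚ[X], I.IsHilbertSamuelPoly P := by
  let F : I.Filtration R := I.stableFiltration I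
  let G : I.Filtration R := I.stableFiltration ⊤
  have hF (n : ℕ) : F.N n = I ^ (n + 1) := (pow_succ I n).symm
  have hG (n : ℕ) : G.N n = I ^ n := Ideal.mul_top _
  have hadd (n : ℕ) : relLength (F.N n) (G.N n) + Module.length R (R ⧸ I ^ n) =
      Module.length R (R ⧸ I ^ (n + 1)) := by
    rw [hF, hG, length_quotient_eq_relLength_add (Ideal.pow_le_pow_right (I := I) n.le_succ)]
  have hfin (n : ℕ) : relLength (F.N n) (G.N n) ≠ ⊤ :=
    ne_top_of_le_ne_top (length_quotient_pow_ne_top (n + 1)) (hadd n ▸ le_self_add)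
  have hdiff : (fun n : ℕ ↦ (I.hilbertSamuelFun (n + 1 : ℕ) : ℚ) - I.hilbertSamuelFun n) =
      relHilbertFun F G := by
    ext n
    have htoNat := congrArg ENat.toNat (hadd n)
    rw [ENat.toNat_add (hfin n) (length_quotient_pow_ne_top n)] at htoNat
    simp only [Ideal.hilbertSamuelFun, Int.toNat_natCast, ← htoNat, Nat.cast_add, relHilbertFun,
      add_sub_cancel_right]
  obtain ⟨P, hP⟩ := EventuallyPolynomial.of_succ_sub
    (u := fun n : ℕ ↦ (I.hilbertSamuelFun n : ℚ)) (hdiff ▸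
    eventuallyPolynomial_relHilbertFun (I.stableFiltration_stable ⊤)
      (fun n ↦ Submodule.smul_mono le_rfl le_top) hfin)
  obtain ⟨N, hN⟩ := eventually_atTop.1 hP
  refine ⟨P, eventually_atTop.2 ⟨N, fun n hn ↦ ?_⟩⟩
  lift n to ℕ using by omega
  exact_mod_cast (hN n (by exact_mod_cast hn)).symm

theorem length_quotient_eq_length_quotient_colon_add (J : Ideal R) (x : R) :
    Module.length R (R ⧸ J) =
      Module.length R (R ⧸ J.colon {x}) + Module.length R (R ⧸ (J ⊔ Ideal.span {x})) := by
  have hspan : Ideal.span {x} = Submodule.map (LinearMap.mulRight R x) ⊤ := by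
    ext a
    simp [Ideal.mem_span_singleton']
  have hcolon : Submodule.comap (LinearMap.mulRight R x) J = J.colon {x} := by
    ext a
    simp [Submodule.mem_colon_singleton]
  rw [length_quotient_eq_relLength_add (le_sup_left (b := Ideal.span {x})), relLength_sup_right,
    hspan, relLength_map, relLength_top, hcolon]

theorem length_quotient_modElement_pow (I : Ideal R) (x : R) (n : ℕ) :
    Module.length (R ⧸ Ideal.span {x}) ((R ⧸ Ideal.span {x}) ⧸ I.modElement x ^ n) =
      Module.length R (R ⧸ (I ^ n ⊔ Ideal.span {x})) := by
  rw [Ideal.modElement, ← Ideal.map_pow, ← Module.length_eq_of_surjective (S := R)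
    (R := R ⧸ Ideal.span {x}) Ideal.Quotient.mk_surjective, sup_comm]
  exact (DoubleQuot.quotQuotEquivQuotSupₐ R (Ideal.span {x}) (I ^ n)).toLinearEquiv.length_eq

theorem isArtinianRing_quotient_modElement [IsArtinianRing (R ⧸ I)] (hx : x ∈ I) :
    IsArtinianRing ((R ⧸ Ideal.span {x}) ⧸ I.modElement x) :=
  (DoubleQuot.quotQuotEquivQuotOfLE
    (I.span_singleton_le_iff_mem.2 hx)).symm.surjective.isArtinianRing

theorem modElement_ne_top (hI : I ≠ ⊤) (hx : x ∈ I) : I.modElement x ≠ ⊤ := by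
  rw [← Ideal.Quotient.nontrivial_iff] at hI ⊢
  exact (DoubleQuot.quotQuotEquivQuotOfLE
    (I.span_singleton_le_iff_mem.2 hx)).toEquiv.nontrivial

theorem pow_le_colon_pow_succ (hx : x ∈ I) (n : ℕ) : I ^ n ≤ (I ^ (n + 1)).colon {x} :=
  fun _ ha ↦ Submodule.mem_colon_singleton.2 (pow_succ I n ▸ Ideal.mul_mem_mul ha hx)

theorem hilbertSamuelFun_add_relLength_colon [IsNoetherianRing R] [IsArtinianRing (R ⧸ I)]
    (hx : x ∈ I) (n : ℕ) :
    I.hilbertSamuelFun (n + 1) + relLength (I ^ n) ((I ^ (n + 1)).colon {x}) =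
      (I.modElement x).hilbertSamuelFun (n + 1) + I.hilbertSamuelFun n := by
  have := isArtinianRing_quotient_modElement hx
  rw [coe_hilbertSamuelFun, coe_hilbertSamuelFun, coe_hilbertSamuelFun,
    length_quotient_modElement_pow, Int.toNat_natCast, Int.toNat_natCast_add_one,
    length_quotient_eq_length_quotient_colon_add _ x,
    length_quotient_eq_relLength_add (pow_le_colon_pow_succ hx n)]
  ring

theorem hilbertSamuelFun_eq_add_iff [IsNoetherianRing R] [IsArtinianRing (R ⧸ I)]
    (hx : x ∈ I) (n : ℕ) :
    I.hilbertSamuelFun (n + 1) = (I.modElement x).hilbertSamuelFun (n + 1) + I.hilbertSamuelFun n ↔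
      (I ^ (n + 1)).colon {x} = I ^ n := by
  rw [← (pow_le_colon_pow_succ hx n).ge_iff_eq', ← relLength_eq_zero_iff]
  have hadd := hilbertSamuelFun_add_relLength_colon hx n
  generalize relLength (I ^ n) ((I ^ (n + 1)).colon {x}) = l at *
  lift l to ℕ using fun htop ↦ by
    rw [htop, add_top, ← Nat.cast_add] at hadd
    exact ENat.top_ne_natCast _ hadd
  norm_cast at *
  omega

end HilbertSamuel

section Superficial

variable {R : Type*} [CommRing R] {I : Ideal R} {x : R}

theorem mem_iInf_pow_iff [IsNoetherianRing R] {a : R} :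
    a ∈ ⨅ n : ℕ, I ^ n ↔ ∃ r ∈ I, r * a = a := by
  simpa using I.mem_iInf_smul_pow_eq_bot_iff a

theorem mem_iInf_pow_of_mul_mem [IsNoetherianRing R] {y a : R} (hy : y ∈ nonZeroDivisors R)
    (ha : y * a ∈ ⨅ n : ℕ, I ^ n) : a ∈ ⨅ n : ℕ, I ^ n := by
  obtain ⟨r, hr, hra⟩ := mem_iInf_pow_iff.1 ha
  exact mem_iInf_pow_iff.2 ⟨r, hr, (mul_cancel_left_mem_nonZeroDivisors hy).1 (by
    rw [mul_left_comm, hra])⟩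

theorem mem_iInf_pow_of_mul_superficial_eq_zero [IsNoetherianRing R] (hx : I.IsSuperficial x)
    {y : R} (hyI : y ∈ I) (hy : y ∈ nonZeroDivisors R) {a : R} (ha : a * x = 0) :
    a ∈ ⨅ n : ℕ, I ^ n := by
  obtain ⟨-, c, -, hsup⟩ := hx
  have hyc : y ^ c * a ∈ I ^ c := Ideal.mul_mem_right _ _ (Ideal.pow_mem_pow hyI c)
  refine mem_iInf_pow_of_mul_mem (pow_mem hy c) ((Submodule.mem_iInf _).2 fun n ↦ ?_)
  rcases le_total c n with hn | hn
  · refine hsup n hn ▸ ⟨Submodule.mem_colon_singleton.2 ?_, hyc⟩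
    rw [smul_eq_mul, mul_assoc, ha, mul_zero]
    exact zero_mem _
  · exact Ideal.pow_le_pow_right hn hyc

theorem eventually_pow_succ_colon_eq [IsNoetherianRing R] (hx : I.IsSuperficial x)
    {y : R} (hyI : y ∈ I) (hy : y ∈ nonZeroDivisors R) :
    ∀ᶠ n in atTop, (I ^ (n + 1)).colon {x} = I ^ n := by
  have hann {a : R} := mem_iInf_pow_of_mul_superficial_eq_zero hx hyI hy (a := a)
  obtain ⟨hxI, c, -, hsup⟩ := hx
  obtain ⟨k, hk⟩ := I.exists_pow_inf_eq_pow_smul (M := R) (Ideal.span {x})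
  refine eventually_atTop.2 ⟨k + c, fun n hn ↦ ?_⟩
  refine le_antisymm (fun a ha ↦ ?_) (pow_le_colon_pow_succ hxI n)
  refine hsup n (by omega) ▸ ⟨ha, ?_⟩
  have hmem : a * x ∈ I ^ (n + 1) • (⊤ : Submodule R R) ⊓ Ideal.span {x} :=
    ⟨by simpa using Submodule.mem_colon_singleton.1 ha, Ideal.mem_span_singleton'.2 ⟨a, rfl⟩⟩
  rw [hk (n + 1) (by omega)] at hmem
  obtain ⟨b, hb, hba⟩ := Ideal.mem_mul_span_singleton.1
    (Submodule.smul_mono le_rfl inf_le_right hmem)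
  have hab : a - b ∈ I ^ c :=
    iInf_le (fun n : ℕ ↦ I ^ n) c (hann (by rw [sub_mul, hba, sub_self]))
  exact (Submodule.sub_mem_iff_left _ (Ideal.pow_le_pow_right (by omega) hb)).1 hab

theorem mem_pow_of_mul_pow_mem {N n k : ℕ} (hN : ∀ n ≥ N, (I ^ (n + 1)).colon {x} = I ^ n)
    (hn : N ≤ n) {a : R} (ha : a * x ^ k ∈ I ^ (n + k)) : a ∈ I ^ n := by
  induction k with
  | zero => simpa using ha
  | succ k ih =>
    refine ih ?_
    rw [← hN (n + k) (by omega), Submodule.mem_colon_singleton, smul_eq_mul, mul_assoc, ← pow_succ]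
    exact ha

theorem mem_ratliffRush_pow (hx : x ∈ I)
    (hcolon : ∀ᶠ n in atTop, (I ^ (n + 1)).colon {x} = I ^ n) {n : ℕ} (hn : 1 ≤ n) {a : R} :
    a ∈ (I ^ n).ratliffRush ↔ ∃ k : ℕ, a * x ^ k ∈ I ^ (n + k) := by
  obtain ⟨N, hN⟩ := eventually_atTop.1 hcolon
  simp only [Ideal.mem_ratliffRush, ← pow_mul]
  constructor
  · rintro ⟨k, -, hk⟩
    exact ⟨n * k, by simpa [mul_add, add_comm] using hk _ (Ideal.pow_mem_pow hx _)⟩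
  · rintro ⟨k, hk⟩
    refine ⟨N + 1, by omega, fun b hb ↦ mem_pow_of_mul_pow_mem (k := k) hN (by nlinarith) ?_⟩
    have hmul := Ideal.mul_mem_mul hk hb
    rwa [← pow_add, mul_right_comm, add_right_comm, ← mul_one_add, add_comm 1] at hmul

theorem mul_mem_ratliffRush_pow_succ (hx : x ∈ I)
    (hcolon : ∀ᶠ n in atTop, (I ^ (n + 1)).colon {x} = I ^ n) {n : ℕ} (hn : 1 ≤ n) {a : R} :
    a * x ∈ (I ^ (n + 1)).ratliffRush ↔ a ∈ (I ^ n).ratliffRush := by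
  rw [mem_ratliffRush_pow hx hcolon hn, mem_ratliffRush_pow hx hcolon (by omega)]
  constructor
  · rintro ⟨k, hk⟩
    refine ⟨k + 1, ?_⟩
    rwa [pow_succ', ← mul_assoc, ← add_assoc, add_right_comm]
  · rintro ⟨k, hk⟩
    refine ⟨k, ?_⟩
    rw [mul_right_comm, add_right_comm, pow_succ]
    exact Ideal.mul_mem_mul hk hx

theorem ratliffRush_pow_succ_colon (hx : x ∈ I)
    (hcolon : ∀ᶠ n in atTop, (I ^ (n + 1)).colon {x} = I ^ n) {n : ℕ} (hn : 1 ≤ n) :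
    (I ^ (n + 1)).ratliffRush.colon {x} = (I ^ n).ratliffRush :=
  Submodule.ext fun _ ↦ Submodule.mem_colon_singleton.trans
    (mul_mem_ratliffRush_pow_succ hx hcolon hn)

theorem le_ratliffRush (I : Ideal R) : I ≤ I.ratliffRush := fun a ha ↦
  Ideal.mem_ratliffRush.2 ⟨1, le_rfl, fun b hb ↦ by
    rw [pow_succ', pow_one]
    exact Ideal.mul_mem_mul ha (by simpa using hb)⟩

theorem forall_ratliffRush_pow_eq_iff (hx : x ∈ I)
    (hcolon : ∀ᶠ n in atTop, (I ^ (n + 1)).colon {x} = I ^ n) {i : ℕ} (hi : 1 ≤ i) :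
    (∀ n ≥ i, (I ^ n).ratliffRush = I ^ n) ↔ ∀ n ≥ i, (I ^ (n + 1)).colon {x} = I ^ n := by
  constructor
  · intro h n hn
    rw [← h n hn, ← h (n + 1) (by omega), ratliffRush_pow_succ_colon hx hcolon (by omega)]
  · refine fun h n hn ↦ le_antisymm (fun a ha ↦ ?_) (le_ratliffRush _)
    obtain ⟨k, hk⟩ := (mem_ratliffRush_pow hx hcolon (by omega)).1 ha
    exact mem_pow_of_mul_pow_mem h hn hk

theorem isLeast_stabilityIndex (hx : x ∈ I)
    (hcolon : ∀ᶠ n in atTop, (I ^ (n + 1)).colon {x} = I ^ n) :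
    IsLeast {i | 1 ≤ i ∧ ∀ n ≥ i, (I ^ (n + 1)).colon {x} = I ^ n} I.stabilityIndex := by
  have hset : {i | 1 ≤ i ∧ ∀ n ≥ i, (I ^ n).ratliffRush = I ^ n} =
      {i | 1 ≤ i ∧ ∀ n ≥ i, (I ^ (n + 1)).colon {x} = I ^ n} :=
    Set.ext fun i ↦ and_congr_right (forall_ratliffRush_pow_eq_iff hx hcolon)
  obtain ⟨N, hN⟩ := eventually_atTop.1 hcolon
  rw [Ideal.stabilityIndex, hset]
  exact ⟨Nat.sInf_mem ⟨N + 1, by omega, fun n hn ↦ hN n (by omega)⟩, fun i hi ↦ Nat.sInf_le hi⟩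

end Superficial

section PostulationNumber

variable {R : Type*} [CommRing R] {I : Ideal R} {x : R}

/-- The Grothendieck–Serre difference `t ↦ P_I(t) - H_I(t)`, whose last nonzero value is at the
postulation number. -/
noncomputable def hilbertSamuelDifference (I : Ideal R) (t : ℤ) : ℚ :=
  I.hilbertSamuelPoly.eval (t : ℚ) - I.hilbertSamuelFun t

theorem isHilbertSamuelPoly_hilbertSamuelPoly [IsNoetherianRing R] [IsArtinianRing (R ⧸ I)] :
    I.IsHilbertSamuelPoly I.hilbertSamuelPoly := by
  obtain ⟨P, hP⟩ := exists_isHilbertSamuelPoly (I := I)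
  exact hP.hilbertSamuelPoly_eq.symm ▸ hP

theorem support_hilbertSamuelDifference_nonempty [IsNoetherianRing R] [IsArtinianRing (R ⧸ I)]
    (hI : I ≠ ⊤) : (Function.support (hilbertSamuelDifference I)).Nonempty := by
  by_contra hempty
  have hdiff (t : ℤ) : I.hilbertSamuelPoly.eval (t : ℚ) = I.hilbertSamuelFun t :=
    sub_eq_zero.1 (congrFun (Function.support_eq_empty_iff.1 (Set.not_nonempty_iff_eq_empty.1
      hempty)) t)
  have hzero : I.hilbertSamuelPoly = 0 := by
    refine eq_zero_of_infinite_isRoot _ (((Set.Iic_infinite (0 : ℤ)).image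
      (Int.cast_injective (α := ℚ)).injOn).mono ?_)
    rintro _ ⟨t, ht, rfl⟩
    exact (hdiff t).trans (by rw [hilbertSamuelFun_of_nonpos ht, Nat.cast_zero])
  refine hilbertSamuelFun_one_ne_zero hI ?_
  have hone := hdiff 1
  rw [hzero, eval_zero] at hone
  exact_mod_cast hone.symm

theorem isGreatest_postulationNumber [IsNoetherianRing R] [IsArtinianRing (R ⧸ I)] (hI : I ≠ ⊤) :
    IsGreatest (Function.support (hilbertSamuelDifference I)) I.postulationNumber := by
  have hset : {n : ℤ | ∀ t : ℤ, n < t → I.hilbertSamuelPoly.eval (t : ℚ) = I.hilbertSamuelFun t} =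
      upperBounds (Function.support (hilbertSamuelDifference I)) := by
    ext n
    refine forall_congr' fun t ↦ ?_
    rw [Function.mem_support, hilbertSamuelDifference, sub_ne_zero, ← not_lt, not_imp_not]
  have hne := support_hilbertSamuelDifference_nonempty hI
  have hbdd : BddAbove (Function.support (hilbertSamuelDifference I)) := by
    obtain ⟨N, hN⟩ := eventually_atTop.1 (isHilbertSamuelPoly_hilbertSamuelPoly (I := I))
    exact ⟨N, hset ▸ fun t ht ↦ hN t ht.le⟩
  rw [Ideal.postulationNumber, hset, csInf_upperBounds_eq_csSup hbdd hne]
  exact ⟨Int.csSup_mem hne hbdd, fun t ht ↦ le_csSup hbdd ht⟩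

theorem hilbertSamuelPoly_modElement [IsNoetherianRing R] [IsArtinianRing (R ⧸ I)] (hx : x ∈ I)
    (hcolon : ∀ᶠ n in atTop, (I ^ (n + 1)).colon {x} = I ^ n) :
    (I.modElement x).hilbertSamuelPoly =
      I.hilbertSamuelPoly - I.hilbertSamuelPoly.comp (X - 1) := by
  obtain ⟨N, hN⟩ := eventually_atTop.1 hcolon
  obtain ⟨M, hM⟩ := eventually_atTop.1 (isHilbertSamuelPoly_hilbertSamuelPoly (I := I))
  refine Ideal.IsHilbertSamuelPoly.hilbertSamuelPoly_eq
    (eventually_atTop.2 ⟨max (N + 1) (M + 1), fun t ht ↦ ?_⟩)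
  obtain ⟨n, rfl⟩ : ∃ n : ℕ, t = n + 1 := ⟨(t - 1).toNat, by omega⟩
  have hadd := (hilbertSamuelFun_eq_add_iff hx n).2 (hN n (by omega))
  have hn := hM n (by omega)
  have hn1 := hM (n + 1) (by omega)
  simp only [eval_sub, eval_comp, eval_X, eval_one, hn1, hadd]
  push_cast at hn ⊢
  rw [add_sub_cancel_right, hn, add_sub_cancel_right]

theorem hilbertSamuelDifference_modElement_of_nonpos [IsNoetherianRing R] [IsArtinianRing (R ⧸ I)]
    (hx : x ∈ I) (hcolon : ∀ᶠ n in atTop, (I ^ (n + 1)).colon {x} = I ^ n) {t : ℤ} (ht : t ≤ 0) :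
    hilbertSamuelDifference (I.modElement x) t =
      hilbertSamuelDifference I t - hilbertSamuelDifference I (t - 1) := by
  simp only [hilbertSamuelDifference, hilbertSamuelPoly_modElement hx hcolon, eval_sub, eval_comp,
    eval_X, eval_one, hilbertSamuelFun_of_nonpos ht,
    hilbertSamuelFun_of_nonpos (show t - 1 ≤ 0 by omega)]
  push_cast
  ring

theorem hilbertSamuelDifference_modElement_succ_iff [IsNoetherianRing R] [IsArtinianRing (R ⧸ I)]
    (hx : x ∈ I) (hcolon : ∀ᶠ n in atTop, (I ^ (n + 1)).colon {x} = I ^ n) (n : ℕ) :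
    hilbertSamuelDifference (I.modElement x) (n + 1) =
      hilbertSamuelDifference I (n + 1) - hilbertSamuelDifference I n ↔
        (I ^ (n + 1)).colon {x} = I ^ n := by
  rw [← hilbertSamuelFun_eq_add_iff hx, ← @Nat.cast_inj ℚ]
  simp only [hilbertSamuelDifference, hilbertSamuelPoly_modElement hx hcolon, eval_sub, eval_comp,
    eval_X, eval_one]
  push_cast
  rw [add_sub_cancel_right]
  constructor <;> intro h <;> linarith

theorem hilbertSamuelDifference_modElement [IsNoetherianRing R] [IsArtinianRing (R ⧸ I)]
    (hx : x ∈ I) (hcolon : ∀ᶠ n in atTop, (I ^ (n + 1)).colon {x} = I ^ n) {t : ℤ}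
    (ht : t ≤ 0 ∨ (I.stabilityIndex : ℤ) < t) :
    hilbertSamuelDifference (I.modElement x) t =
      hilbertSamuelDifference I t - hilbertSamuelDifference I (t - 1) := by
  rcases ht with ht | ht
  · exact hilbertSamuelDifference_modElement_of_nonpos hx hcolon ht
  · obtain ⟨n, rfl⟩ : ∃ n : ℕ, t = n + 1 := ⟨(t - 1).toNat, by omega⟩
    rw [add_sub_cancel_right, hilbertSamuelDifference_modElement_succ_iff hx hcolon]
    exact (isLeast_stabilityIndex hx hcolon).1.2 n (by omega)

theorem hilbertSamuelDifference_modElement_stabilityIndex_ne [IsNoetherianRing R]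
    [IsArtinianRing (R ⧸ I)] (hx : x ∈ I)
    (hcolon : ∀ᶠ n in atTop, (I ^ (n + 1)).colon {x} = I ^ n) (hI : 1 < I.stabilityIndex) :
    hilbertSamuelDifference (I.modElement x) I.stabilityIndex ≠
      hilbertSamuelDifference I I.stabilityIndex -
        hilbertSamuelDifference I (I.stabilityIndex - 1) := by
  obtain ⟨⟨-, hstable⟩, hmin⟩ := isLeast_stabilityIndex hx hcolon
  obtain ⟨n, hn⟩ := Nat.exists_eq_add_of_lt hI
  rw [hn, add_comm 1 n] at hstable hmin ⊢
  rw [Nat.cast_succ, add_sub_cancel_right, Ne,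
    hilbertSamuelDifference_modElement_succ_iff hx hcolon]
  intro hcolon_eq
  refine absurd (hmin ⟨by omega, fun m hm ↦ ?_⟩) (Nat.not_succ_le_self (n + 1))
  obtain rfl | hlt := hm.eq_or_lt
  exacts [hcolon_eq, hstable m hlt]

end PostulationNumber

section IsGreatestSupport

variable {A : Type*} [AddGroup A] {u v : ℤ → A} {m n t : ℤ}

theorem eq_zero_of_isGreatest_support (hm : IsGreatest (Function.support u) m) (ht : m < t) :
    u t = 0 :=
  Function.notMem_support.1 fun hut ↦ (hm.2 hut).not_gt ht

theorem add_one_le_of_isGreatest_support (hm : IsGreatest (Function.support u) m)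
    (hn : IsGreatest (Function.support v) n) (h : v (m + 1) = u (m + 1) - u m) : m + 1 ≤ n := by
  rw [eq_zero_of_isGreatest_support hm (lt_add_one m), zero_sub] at h
  exact hn.2 fun hv ↦ hm.1 (neg_eq_zero.1 (h.symm.trans hv))

theorem le_add_one_of_isGreatest_support (hm : IsGreatest (Function.support u) m)
    (hn : IsGreatest (Function.support v) n) (h : ∀ t, m + 1 < t → v t = u t - u (t - 1)) :
    n ≤ m + 1 := by
  by_contra! hlt
  refine hn.1 ?_
  rw [h n hlt, eq_zero_of_isGreatest_support hm (by omega),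
    eq_zero_of_isGreatest_support hm (by omega), sub_zero]

theorem le_of_ne_sub_of_isGreatest_support (hm : IsGreatest (Function.support u) m)
    (hn : IsGreatest (Function.support v) n) (hmt : m < t - 1) (h : v t ≠ u t - u (t - 1)) :
    t ≤ n := by
  rw [eq_zero_of_isGreatest_support hm hmt, eq_zero_of_isGreatest_support hm (by omega),
    sub_zero] at h
  exact hn.2 h

end IsGreatestSupport

theorem proposition3p1_general {R : Type*} [CommRing R] [IsNoetherianRing R]
    (I : Ideal R) [IsArtinianRing (R ⧸ I)] (hI : I ≠ ⊤)
    (hreg : ∃ y ∈ I, y ∈ nonZeroDivisors R) (x : R) (hx : I.IsSuperficial x) :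
    (I.postulationNumber > (I.stabilityIndex : ℤ) - 1 →
        (I.modElement x).postulationNumber = I.postulationNumber + 1) ∧
      (I.postulationNumber = (I.stabilityIndex : ℤ) - 1 →
        (I.modElement x).postulationNumber ≤ I.postulationNumber + 1) ∧
      (I.postulationNumber < (I.stabilityIndex : ℤ) - 1 →
        (I.modElement x).postulationNumber ≥ I.postulationNumber + 1) := by
  obtain ⟨y, hyI, hy⟩ := hreg
  have hcolon := eventually_pow_succ_colon_eq hx hyI hy
  have := isArtinianRing_quotient_modElement hx.1
  have hn := isGreatest_postulationNumber hI
  have hn' := isGreatest_postulationNumber (modElement_ne_top hI hx.1)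
  have hdiff {t : ℤ} := hilbertSamuelDifference_modElement hx.1 hcolon (t := t)
  have hle (h : I.postulationNumber ≥ (I.stabilityIndex : ℤ) - 1) :
      (I.modElement x).postulationNumber ≤ I.postulationNumber + 1 :=
    le_add_one_of_isGreatest_support hn hn' fun t ht ↦ hdiff (.inr (by omega))
  have hge (h : I.postulationNumber + 1 ≤ 0 ∨ I.stabilityIndex < I.postulationNumber + 1) :
      I.postulationNumber + 1 ≤ (I.modElement x).postulationNumber :=
    add_one_le_of_isGreatest_support hn hn' (by simpa using hdiff h)
  refine ⟨fun h ↦ (hle h.le).antisymm (hge (.inr (by omega))), fun h ↦ hle h.ge, fun h ↦ ?_⟩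
  rcases le_or_gt (I.postulationNumber + 1) 0 with hneg | hpos
  · exact hge (.inl hneg)
  · exact le_trans (by omega) (le_of_ne_sub_of_isGreatest_support hn hn' h
      (hilbertSamuelDifference_modElement_stabilityIndex_ne hx.1 hcolon (by omega)))

theorem isArtinianRing_quotient_of_maximalIdeal_le_radical {R : Type*} [CommRing R] [IsLocalRing R]
    [IsNoetherianRing R] {I : Ideal R} (hI : IsLocalRing.maximalIdeal R ≤ I.radical) :
    IsArtinianRing (R ⧸ I) :=
  have : IsArtinianRing (R ⧸ IsLocalRing.maximalIdeal R) :=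
    inferInstanceAs (IsArtinianRing (IsLocalRing.ResidueField R))
  isArtinianRing_quotient_of_le_radical hI

theorem IsCohenMacaulayLocal.exists_mem_mem_nonZeroDivisors {R : Type*} [CommRing R]
    [IsLocalRing R] (hCM : IsCohenMacaulayLocal R) (hdim : 0 < ringKrullDim R) {I : Ideal R}
    (hI : IsLocalRing.maximalIdeal R ≤ I.radical) : ∃ y ∈ I, y ∈ nonZeroDivisors R := by
  obtain ⟨-, rs, hmem, hreg, hlen⟩ := hCM
  cases rs with
  | nil => simp [← hlen] at hdim
  | cons y rs =>
    have hy : IsRegular y := isLeftRegular_iff_isRegular.1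
      ((RingTheory.Sequence.isRegular_cons_iff _ _ _).1 hreg).1.isLeftRegular
    obtain ⟨k, hk⟩ := hI (hmem y List.mem_cons_self)
    exact ⟨y ^ k, hk, pow_mem (isRegular_iff_mem_nonZeroDivisors.1 hy) k⟩

theorem proposition3p1 {R : Type*} [CommRing R] [IsLocalRing R]
    (hCM : IsCohenMacaulayLocal R) (hdim : 0 < ringKrullDim R)
    (hres : Infinite (IsLocalRing.ResidueField R))
    (I : Ideal R) (hI : I.IsMaximalPrimary) (x : R) (hx : I.IsSuperficial x) :
    (I.postulationNumber > (I.stabilityIndex : ℤ) - 1 →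
        (I.modElement x).postulationNumber = I.postulationNumber + 1) ∧
      (I.postulationNumber = (I.stabilityIndex : ℤ) - 1 →
        (I.modElement x).postulationNumber ≤ I.postulationNumber + 1) ∧
      (I.postulationNumber < (I.stabilityIndex : ℤ) - 1 →
        (I.modElement x).postulationNumber ≥ I.postulationNumber + 1) := by
  have := hCM.1
  have := isArtinianRing_quotient_of_maximalIdeal_le_radical hI.2.ge
  exact proposition3p1_general I hI.1.ne_top (hCM.exists_mem_mem_nonZeroDivisors hdim hI.2.ge) x hx
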